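/- Let $R$ be a commutative noetherian ring, let $I, J$ be ideals of $R$, and let $\mathcal{S}$ be a Serre class of $R$-modules, i.e. a class of $R$-modules that contains $0$ and is closed under submodules, quotients and extensions. Put $$W(I,J)=\{\mathfrak{p}\in\operatorname{Spec}(R) \mid I^n\subseteq \mathfrak{p}+J \text{ for some integer } n\geq 1\}.$$ For an $R$-module $M$ let $\Gamma_{I,J}(M)=\{x\in M\mid \operatorname{Supp}(Rx)\subseteq W(I,J)\}$, let $H^i_{I,J}$ be the $i$-th right derived functor of $\Gamma_{I,J}$, and let $$\operatorname{cd}_{\mathcal{S}}(I,J,M)=\sup\{i\in\mathbb{N}_0\mid H^i_{I,J}(M)\notin\mathcal{S}\}\in\mathbb{N}_0\cup\{\infty\},$$ where the supremum of the empty set is $0$ and that of an unbounded set is $\infty$. Then $$\operatorname{cd}_{\mathcal{S}}(I,J,R)=\sup\{\operatorname{cd}_{\mathcal{S}}(I,J,N)\mid N \text{ is a finitely generated } R\text{-module}\}.$$ Moreover, for every integer $r\geq 0$ the following statements are equivalent: (i) $H^j_{I,J}(R)\in\mathcal{S}$ for all $j>r$; (ii) $H^j_{I,J}(M)\in\mathcal{S}$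 for all $j>r$ and every finitely generated $R$-module $M$. -/

import Mathlib

open CategoryTheory

universe u

namespace PairLC

/-- `W(I, J)`: the primes `p` of `R` with `I ^ n ⊆ p + J` for some `n ≥ 1`. -/
def W {R : Type u} [CommRing R] (I J : Ideal R) : Set (PrimeSpectrum R) :=
  {p | ∃ n : ℕ, 1 ≤ n ∧ I ^ n ≤ p.asIdeal ⊔ J}

/-- A prime `p` lies in the support of the cyclic module `R x` iff no element outside `p`
kills `x`. -/
theorem mem_support_span_singleton {R : Type u} [CommRing R] {M : Type u} [AddCommGroup M]
    [Module R M] (x : M) (p : PrimeSpectrum R) :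
    p ∈ Module.support R (Submodule.span R {x}) ↔ ∀ r ∉ p.asIdeal, r • x ≠ 0 := by
  rw [Module.mem_support_iff']
  constructor
  · rintro ⟨⟨m, hm⟩, h⟩ r hr hx
    obtain ⟨a, rfl⟩ := Submodule.mem_span_singleton.mp hm
    refine h r hr (Subtype.ext ?_)
    change r • a • x = 0
    rw [smul_comm, hx, smul_zero]
  · intro h
    exact ⟨⟨x, Submodule.mem_span_singleton_self x⟩,
      fun r hr hx => h r hr (congrArg Subtype.val hx)⟩

/-- The `(I, J)`-torsion submodule `Γ_{I,J}(M) = {x ∈ M | Supp (R x) ⊆ W(I, J)}`. -/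
def torsion {R : Type u} [CommRing R] (I J : Ideal R) (M : Type u) [AddCommGroup M]
    [Module R M] : Submodule R M where
  carrier := {x | Module.support R (Submodule.span R {x}) ⊆ W I J}
  zero_mem' := by
    intro p hp
    rw [mem_support_span_singleton] at hp
    exact absurd (smul_zero _) (hp 1 ((Ideal.ne_top_iff_one _).mp p.2.ne_top))
  add_mem' := by
    intro x y hx hy p hp
    by_contra hW
    have hx' : ¬ ∀ r ∉ p.asIdeal, r • x ≠ 0 :=
      fun h => hW (hx ((mem_support_span_singleton x p).mpr h))
    have hy' : ¬ ∀ r ∉ p.asIdeal, r • y ≠ 0 :=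
      fun h => hW (hy ((mem_support_span_singleton y p).mpr h))
    push Not at hx' hy'
    obtain ⟨r, hr, hrx⟩ := hx'
    obtain ⟨s, hs, hsy⟩ := hy'
    refine (mem_support_span_singleton _ p).mp hp (r * s)
      (fun h => (p.2.mem_or_mem h).elim hr hs) ?_
    rw [smul_add, mul_smul r s y, hsy, smul_zero, mul_comm, mul_smul, hrx, smul_zero, add_zero]
  smul_mem' := by
    intro a x hx p hp
    refine hx ((mem_support_span_singleton x p).mpr fun r hr h => ?_)
    refine (mem_support_span_singleton _ p).mp hp r hr ?_
    rw [smul_comm, h, smul_zero]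

/-- An `R`-linear map sends `Γ_{I,J}` into `Γ_{I,J}`. -/
theorem map_mem_torsion {R : Type u} [CommRing R] (I J : Ideal R) {M N : Type u}
    [AddCommGroup M] [Module R M] [AddCommGroup N] [Module R N] (f : M →ₗ[R] N) :
    ∀ x ∈ torsion I J M, f x ∈ torsion I J N := by
  intro x hx p hp
  refine hx ((mem_support_span_singleton x p).mpr fun r hr h => ?_)
  refine (mem_support_span_singleton _ p).mp hp r hr ?_
  rw [← map_smul, h, map_zero]

/-- The `(I, J)`-torsion functor `Γ_{I,J}` on `R`-modules. -/
def Γ {R : Type u} [CommRing R] (I J : Ideal R) : ModuleCat.{u} R ⥤ ModuleCat.{u} R where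
  obj M := ModuleCat.of R (torsion I J M)
  map f := ModuleCat.ofHom (f.hom.restrict (map_mem_torsion I J f.hom))

instance Γ_additive {R : Type u} [CommRing R] (I J : Ideal R) : (Γ I J).Additive where
  map_add := rfl

/-- Local cohomology `H^i_{I,J}(M)` with respect to the pair `(I, J)`: the `i`-th right derived
functor of `Γ_{I,J}` at `M`. -/
noncomputable def H {R : Type u} [CommRing R] (I J : Ideal R) (i : ℕ) (M : ModuleCat.{u} R) :
    ModuleCat.{u} R :=
  ((Γ I J).rightDerived i).obj M

/-- The Serre cohomological dimension `cd_S(I, J, M) = sup {i ∈ ℕ | H^i_{I,J}(M) ∉ S}`, which is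
`∞` if the set is unbounded and `0` (the supremum in `ℕ`) if it is empty. -/
noncomputable def cd {R : Type u} [CommRing R] (S : ObjectProperty (ModuleCat.{u} R))
    (I J : Ideal R) (M : ModuleCat.{u} R) : ℕ∞ :=
  sSup ((fun i : ℕ => (i : ℕ∞)) '' {i : ℕ | ¬ S (H I J i M)})

end PairLC

/-!
The heart of the matter is that `H^i_{I,J}` vanishes for all modules once `i` exceeds the number of
generators of `I` (`exists_forall_isZero_H`). Given this bound, `H_mem_of_finite` proceeds by
descending induction on the degree: from `0 → K → Rⁿ → M → 0` the module `H^j(M)` is squeezed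
between `H^j(Rⁿ) ≅ H^j(R)ⁿ` and `H^{j+1}(K)`, where `K` is finitely generated because `R` is
noetherian. The equality of suprema is a formal consequence.

The vanishing is shown on elements of an injective resolution, by induction on the number of
generators (`torsion_exact_of_exact`). Being `(I, J)`-torsion for `I = (a₁, …, aₛ)` means being
torsion for each `((aᵢ), J)`, that is, killed by some `aᵢ ^ n + j` with `j ∈ J`. In an injective
module over a noetherian ring one can divide by such an element up to torsion
(`exists_pow_smul_eq_of_injective`), and each new generator therefore costs one degree of exactness.

The piece `H^j(P) → H^j(M) → H^{j+1}(K)` of the long exact sequence comes from an explicit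
injective resolution of `K`: the fibre of a map of resolutions lifting `P → M`
(`exists_injectiveResolution_fibre`).
-/

namespace PairLC

variable {R : Type u} [CommRing R]

/-! ### Torsion with respect to a pair of ideals -/

/-- Whether `x` is `(I, J)`-torsion depends only on the annihilator of `x`, in a monotone way. -/
theorem mem_torsion_of_annihilator {I J : Ideal R} {M N : Type u} [AddCommGroup M] [Module R M]
    [AddCommGroup N] [Module R N] {x : M} {y : N} (hx : x ∈ torsion I J M)
    (h : ∀ r : R, r • x = 0 → r • y = 0) : y ∈ torsion I J N := by
  intro p hp
  refine hx ((mem_support_span_singleton x p).mpr fun r hr hrx => ?_)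
  exact (mem_support_span_singleton y p).mp hp r hr (h r hrx)

theorem W_sup (I I' J : Ideal R) : W (I ⊔ I') J = W I J ∩ W I' J := by
  ext p
  constructor
  · rintro ⟨n, hn, h⟩
    exact ⟨⟨n, hn, (Ideal.pow_right_mono le_sup_left n).trans h⟩,
      ⟨n, hn, (Ideal.pow_right_mono le_sup_right n).trans h⟩⟩
  · rintro ⟨⟨n, hn, h⟩, m, hm, h'⟩
    exact ⟨n + m, by omega, Ideal.sup_pow_add_le_pow_sup_pow.trans (sup_le h h')⟩

theorem torsion_sup (I I' J : Ideal R) (M : Type u) [AddCommGroup M] [Module R M] :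
    torsion (I ⊔ I') J M = torsion I J M ⊓ torsion I' J M := by
  ext x
  change Module.support R (Submodule.span R {x}) ⊆ W (I ⊔ I') J ↔ _
  rw [W_sup, Set.subset_inter_iff]
  rfl

theorem torsion_bot (J : Ideal R) (M : Type u) [AddCommGroup M] [Module R M] :
    torsion ⊥ J M = ⊤ :=
  eq_top_iff.mpr fun _ _ _ _ => ⟨1, le_rfl, by simp⟩

/-- For a principal ideal `(a)`, an `((a), J)`-torsion element is killed by an element of the
multiplicative set `{a ^ n + j | j ∈ J}`: every prime over `ann x + J` contains `a`, so `a` lies in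
the radical of `ann x + J`. -/
theorem exists_smul_eq_zero_of_mem_torsion {a : R} {J : Ideal R} {M : Type u} [AddCommGroup M]
    [Module R M] {x : M} (hx : x ∈ torsion (Ideal.span {a}) J M) :
    ∃ n : ℕ, ∃ j ∈ J, (a ^ n + j) • x = 0 := by
  let A : Ideal R := LinearMap.ker (LinearMap.toSpanSingleton R M x)
  have ha : a ∈ (A ⊔ J).radical := by
    rw [Ideal.radical_eq_sInf, Submodule.mem_sInf]
    rintro q ⟨hq, hp⟩
    obtain ⟨n, -, hn⟩ := hx ((mem_support_span_singleton x ⟨q, hp⟩).mpr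
      fun r hr h => hr (hq (Ideal.mem_sup_left h)))
    refine hp.mem_of_pow_mem n ?_
    have := hn (Ideal.pow_mem_pow (Ideal.mem_span_singleton_self a) n)
    rwa [sup_eq_left.mpr (le_sup_right.trans hq)] at this
  obtain ⟨n, hn⟩ := ha
  obtain ⟨b, hb, j, hj, h⟩ := Submodule.mem_sup.mp hn
  refine ⟨n, -j, J.neg_mem hj, ?_⟩
  rw [← h, add_neg_cancel_right]
  exact hb

/-- The converse of `exists_smul_eq_zero_of_mem_torsion`, with powers of `a ^ n + j` allowed. -/
theorem mem_torsion_of_pow_smul_eq_zero {a : R} {J : Ideal R} {M : Type u} [AddCommGroup M]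
    [Module R M] {x : M} {n k : ℕ} {j : R} (hj : j ∈ J) (h : (a ^ n + j) ^ k • x = 0) :
    x ∈ torsion (Ideal.span {a}) J M := by
  intro p hp
  have hk : (a ^ n + j) ^ k ∈ p.asIdeal := by
    by_contra hk
    exact (mem_support_span_singleton x p).mp hp _ hk h
  have han : a ^ n ∈ p.asIdeal ⊔ J := by
    rw [← add_sub_cancel_right (a ^ n) j]
    exact sub_mem (Ideal.mem_sup_left (p.2.mem_of_pow_mem k hk)) (Ideal.mem_sup_right hj)
  refine ⟨n + 1, by omega, ?_⟩
  rw [Ideal.span_singleton_pow, Ideal.span_singleton_le_iff_mem, pow_succ]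
  exact Ideal.mul_mem_right _ _ han

/-- In an injective module over a noetherian ring, every `e` is divisible by `s` up to `s`-power
torsion, and the quotient can be chosen inside the submodule of elements killed by `ann e`. The
latter keeps the quotient in any torsion submodule that contains `e`, so there is no need to know
that torsion submodules of injective modules are injective. -/
theorem exists_pow_smul_eq_of_injective [IsNoetherianRing R] {E : Type u} [AddCommGroup E]
    [Module R E] [Module.Injective R E] (s : R) (e : E) :
    ∃ n : ℕ, ∃ x : E, s ^ (n + 1) • x = s ^ n • e ∧ ∀ r : R, r • e = 0 → r • x = 0 := by
  let A : Ideal R := LinearMap.ker (LinearMap.toSpanSingleton R E e)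
  let K : ℕ →o Ideal R := ⟨fun n => LinearMap.ker (LinearMap.toSpanSingleton R E (s ^ n • e)), by
    refine monotone_nat_of_le_succ fun n r hr => ?_
    change r • s ^ (n + 1) • e = 0
    rw [pow_succ', mul_smul, smul_comm]
    exact (congrArg (s • ·) hr).trans (smul_zero s)⟩
  obtain ⟨n, hn⟩ := monotone_stabilizes_iff_noetherian.mpr ‹IsNoetherianRing R› K
  -- Once the annihilators of `s ^ n • e` are stationary, `s ^ (n + 1) ↦ s ^ n • e` is well defined
  -- on the ideal of `R ⧸ ann e` generated by `s ^ (n + 1)`; extend it to `R ⧸ ann e`.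
  let f : R →ₗ[R] R ⧸ A := A.mkQ ∘ₗ LinearMap.mulLeft R (s ^ (n + 1))
  let g : R →ₗ[R] E := LinearMap.toSpanSingleton R E (s ^ n • e)
  have hker : LinearMap.ker f ≤ LinearMap.ker g := by
    intro r hr
    have h1 : (s ^ (n + 1) * r) • e = 0 := (Submodule.Quotient.mk_eq_zero A).mp hr
    rw [mul_comm, mul_smul] at h1
    exact (hn (n + 1) n.le_succ).ge h1
  obtain ⟨φ, hφ⟩ := Module.Injective.out ((LinearMap.ker f).liftQ f le_rfl)
    (LinearMap.ker_eq_bot.mp (Submodule.ker_liftQ_eq_bot' _ _ rfl))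
    ((LinearMap.ker f).liftQ g hker)
  refine ⟨n, φ (A.mkQ 1), ?_, fun r hr => ?_⟩
  · have := hφ (Submodule.Quotient.mk 1)
    simp only [Submodule.liftQ_apply] at this
    rw [← map_smul, ← map_smul, smul_eq_mul]
    simpa [f, g] using this
  · rw [← map_smul, ← map_smul, smul_eq_mul, mul_one, Submodule.mkQ_apply,
      (Submodule.Quotient.mk_eq_zero A).mpr hr, map_zero]

/-- If a complex of injective modules is exact in positive degrees, then its `(I, J)`-torsion
subcomplex is exact in all degrees greater than the number of generators of `I`. -/
theorem torsion_exact_of_exact [IsNoetherianRing R] (J : Ideal R) (E : ℕ → Type u)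
    [∀ n, AddCommGroup (E n)] [∀ n, Module R (E n)] [∀ n, Module.Injective R (E n)]
    (d : ∀ n, E n →ₗ[R] E (n + 1)) (hd : ∀ n x, d (n + 1) (d n x) = 0)
    (hex : ∀ n x, d (n + 1) x = 0 → ∃ y, d n y = x) (t : Finset R) :
    ∀ n, t.card ≤ n → ∀ x ∈ torsion (Ideal.span (t : Set R)) J (E (n + 1)), d (n + 1) x = 0 →
      ∃ y ∈ torsion (Ideal.span (t : Set R)) J (E n), d n y = x := by
  classical
  induction t using Finset.induction_on with
  | empty =>
    intro n _ x _ hx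
    obtain ⟨y, hy⟩ := hex n x hx
    exact ⟨y, by simp [torsion_bot], hy⟩
  | insert a t ha ih =>
    intro n hn x hxt hx
    rw [Finset.card_insert_of_notMem ha] at hn
    obtain ⟨n, rfl⟩ : ∃ k, n = k + 1 := ⟨n - 1, by omega⟩
    rw [Finset.coe_insert, Ideal.span_insert, torsion_sup] at hxt ⊢
    -- `x = d y` with `y` torsion for the smaller ideal. As `s • x = 0`, also `s • y = d z`. Dividing
    -- `z` by `s` gives `w`, and `y - d w` is killed by a power of `s`.
    obtain ⟨y, hyt, rfl⟩ := ih (n + 1) (by omega) x hxt.2 hx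
    obtain ⟨m, j, hj, hs⟩ := exists_smul_eq_zero_of_mem_torsion hxt.1
    set s := a ^ m + j
    obtain ⟨z, hzt, hz⟩ := ih n (by omega) (s • y) (Submodule.smul_mem _ s hyt) (by
      rw [map_smul, hs])
    obtain ⟨k, w, hw, hann⟩ := exists_pow_smul_eq_of_injective s z
    have hwt := mem_torsion_of_annihilator hzt hann
    refine ⟨y - d n w, ⟨mem_torsion_of_pow_smul_eq_zero (n := m) (k := k + 1) hj ?_,
      sub_mem hyt (map_mem_torsion _ _ (d n) w hwt)⟩, by rw [map_sub, hd, sub_zero]⟩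
    rw [smul_sub, ← map_smul, hw, map_smul, hz, smul_smul, pow_succ, sub_self]

/-! ### Vanishing in large degrees -/

theorem isZero_homology_Γ_of_exact (I J : Ideal R) (K : CochainComplex (ModuleCat.{u} R) ℕ) (n : ℕ)
    (h : ∀ x ∈ torsion I J (K.X (n + 1)), K.d (n + 1) (n + 2) x = 0 →
      ∃ y ∈ torsion I J (K.X n), K.d n (n + 1) y = x) :
    Limits.IsZero ((((Γ I J).mapHomologicalComplex _).obj K).homology (n + 1)) := by
  rw [← HomologicalComplex.exactAt_iff_isZero_homology,
    HomologicalComplex.exactAt_iff' _ n (n + 1) (n + 2) (by simp) (by simp),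
    ShortComplex.moduleCat_exact_iff]
  rintro ⟨x, hx⟩ hd
  obtain ⟨y, hy, rfl⟩ := h x hx (congrArg Subtype.val hd)
  exact ⟨⟨y, hy⟩, rfl⟩

/-- `H^i_{I,J}` vanishes in all degrees greater than the number of generators of `I`, uniformly in
the module. -/
theorem exists_forall_isZero_H [IsNoetherianRing R] (I J : Ideal R) :
    ∃ s : ℕ, ∀ n, s ≤ n → ∀ M : ModuleCat.{u} R, Limits.IsZero (H I J (n + 1) M) := by
  obtain ⟨t, rfl⟩ := (isNoetherianRing_iff_ideal_fg R).mp ‹_› I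
  refine ⟨t.card, fun n hn M => ?_⟩
  let E := injectiveResolution M
  refine Limits.IsZero.of_iso ?_ (E.isoRightDerivedObj (Γ _ J) (n + 1))
  refine isZero_homology_Γ_of_exact _ J E.cocomplex n ?_
  have hE (n : ℕ) : Module.Injective R (E.cocomplex.X n) :=
    Module.injective_module_of_injective_object (inj := E.injective n) _ _
  exact torsion_exact_of_exact J (fun n => E.cocomplex.X n)
    (fun n => (E.cocomplex.d n (n + 1)).hom)
    (fun n x => ConcreteCategory.congr_hom (E.cocomplex.d_comp_d n (n + 1) (n + 2)) x)
    (fun n => (ShortComplex.moduleCat_exact_iff _).mp (E.exact_succ n)) t n hn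

/-! ### Resolving the kernel of a surjection -/

/-- A complex of injective modules that is exact in positive degrees, regarded as an injective
resolution of a module `M` that maps isomorphically onto the kernel of its first differential. -/
noncomputable def injectiveResolutionOfExact {M : ModuleCat.{u} R}
    (K : CochainComplex (ModuleCat.{u} R) ℕ) (hK : ∀ n, Injective (K.X n)) (ι : M ⟶ K.X 0)
    (w : ι ≫ K.d 0 1 = 0) (hι : Function.Injective ι) (h₀ : ∀ x, K.d 0 1 x = 0 → ∃ y, ι y = x)
    (h : ∀ n x, K.d (n + 1) (n + 2) x = 0 → ∃ y, K.d n (n + 1) y = x) :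
    InjectiveResolution M where
  cocomplex := K
  injective := hK
  ι := (CochainComplex.fromSingle₀Equiv _ _).symm ⟨ι, w⟩
  quasiIso := ⟨fun n => by
    cases n
    · rw [CochainComplex.quasiIsoAt₀_iff, ShortComplex.quasiIso_iff_of_zeros]
      · have : (ShortComplex.mk ι (K.d 0 1) w).Exact ∧ Mono ι :=
          ⟨(ShortComplex.moduleCat_exact_iff _).mpr h₀, (ModuleCat.mono_iff_injective ι).mpr hι⟩
        refine (ShortComplex.exact_and_mono_f_iff_of_iso ?_).2 this
        exact ShortComplex.isoMk (Iso.refl _) (Iso.refl _) (Iso.refl _)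
          (by simp; exact (Category.id_comp _).trans (Category.comp_id _).symm)
          (by simp; exact (Category.id_comp _).trans (Category.comp_id _).symm)
      all_goals first | rfl | exact K.shape _ _ (by simp)
    · rename_i n
      rw [quasiIsoAt_iff_exactAt]
      · rw [HomologicalComplex.exactAt_iff' _ n (n + 1) (n + 2) (by simp) (by simp),
          ShortComplex.moduleCat_exact_iff]
        exact h n
      · apply CochainComplex.exactAt_succ_single_obj⟩

section Fibre

variable {B C : CochainComplex (ModuleCat.{u} R) ℕ} (g : B ⟶ C)

/-- The terms `B⁰, B¹ × C⁰, B² × C¹, …` of the fibre of a map of complexes `B ⟶ C`. -/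
def fibreX (B C : CochainComplex (ModuleCat.{u} R) ℕ) : ℕ → ModuleCat.{u} R
  | 0 => B.X 0
  | n + 1 => ModuleCat.of R (B.X (n + 1) × C.X n)

/-- The differential `(b, c) ↦ (-db, gb + dc)` of the fibre of `g : B ⟶ C`. With the sign on `B`,
the inclusions `Cⁿ → Bⁿ⁺¹ × Cⁿ` commute with the differentials. -/
def fibreD : ∀ n : ℕ, fibreX B C n ⟶ fibreX B C (n + 1)
  | 0 => ModuleCat.ofHom ((-(B.d 0 1).hom).prod (g.f 0).hom)
  | n + 1 => ModuleCat.ofHom ((-(B.d (n + 1) (n + 2)).hom ∘ₗ LinearMap.fst R _ _).prod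
      ((g.f (n + 1)).hom ∘ₗ LinearMap.fst R _ _ + (C.d n (n + 1)).hom ∘ₗ LinearMap.snd R _ _))

theorem d_apply_d_apply (K : CochainComplex (ModuleCat.{u} R) ℕ) (i j k : ℕ) (x : K.X i) :
    K.d j k (K.d i j x) = 0 :=
  ConcreteCategory.congr_hom (K.d_comp_d i j k) x

theorem f_apply_d_apply (i j : ℕ) (x : B.X i) : g.f j (B.d i j x) = C.d i j (g.f i x) :=
  ConcreteCategory.congr_hom (g.comm i j).symm x

theorem fibreD_comp (n : ℕ) : fibreD g n ≫ fibreD g (n + 1) = 0 := by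
  cases n with
  | zero =>
    have h (x : B.X 0) : (-(B.d 1 2 (-(B.d 0 1 x))),
        g.f 1 (-(B.d 0 1 x)) + C.d 0 1 (g.f 0 x)) = (0, 0) := by
      simp [d_apply_d_apply, f_apply_d_apply]
    exact ModuleCat.hom_ext (LinearMap.ext h)
  | succ n =>
    have h (x : B.X (n + 1) × C.X n) : (-(B.d (n + 2) (n + 3) (-(B.d (n + 1) (n + 2) x.1))),
        g.f (n + 2) (-(B.d (n + 1) (n + 2) x.1)) +
          C.d (n + 1) (n + 2) (g.f (n + 1) x.1 + C.d n (n + 1) x.2)) = (0, 0) := by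
      simp [d_apply_d_apply, f_apply_d_apply]
    exact ModuleCat.hom_ext (LinearMap.ext h)

/-- The fibre (shifted mapping cone) of a map `g : B ⟶ C` of complexes in nonnegative degrees.
It is again in nonnegative degrees: its term in degree `0` is `B⁰`. -/
def fibre : CochainComplex (ModuleCat.{u} R) ℕ :=
  CochainComplex.of (fibreX B C) (fibreD g) (fibreD_comp g)

theorem fibre_d (n : ℕ) : (fibre g).d n (n + 1) = fibreD g n :=
  CochainComplex.of_d ..

theorem injective_fibreX (hB : ∀ n, Injective (B.X n)) (hC : ∀ n, Injective (C.X n)) (n : ℕ) :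
    Injective (fibreX B C n) := by
  cases n with
  | zero => exact hB 0
  | succ n =>
    have := hB (n + 1)
    have := hC n
    exact Injective.of_iso (ModuleCat.biprodIsoProd (B.X (n + 1)) (C.X n)) inferInstance

end Fibre

/-- Exactness of `H(T₁) → H(T₂) → H(T₃)` in the middle puts `H(T₂)` into a Serre class that
contains the outer two. Only `ker ⊆ range` is needed, which is what `h` says on cycles. -/
theorem prop_homology_of_hom (S : ObjectProperty (ModuleCat.{u} R)) [S.IsSerreClass]
    {T₁ T₂ T₃ : ShortComplex (ModuleCat.{u} R)} (φ : T₁ ⟶ T₂) (ψ : T₂ ⟶ T₃)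
    (h : ∀ x, T₂.g x = 0 → ∀ z, T₃.f z = ψ.τ₂ x →
      ∃ y, T₁.g y = 0 ∧ ∃ w, φ.τ₂ y = x + T₂.f w)
    (h₁ : S T₁.homology) (h₃ : S T₃.homology) : S T₂.homology := by
  let f := (ShortComplex.homologyMap φ).hom
  let g := (ShortComplex.homologyMap ψ).hom
  have hle : LinearMap.ker g ≤ LinearMap.range f := by
    intro x hx
    obtain ⟨c, rfl⟩ := (ModuleCat.epi_iff_surjective T₂.homologyπ).mp inferInstance x
    have hc : T₃.homologyπ (ShortComplex.cyclesMap ψ c) = 0 :=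
      (ConcreteCategory.congr_hom (ShortComplex.homologyπ_naturality ψ) c).symm.trans hx
    obtain ⟨z, hz⟩ := (ShortComplex.moduleCat_exact_iff _).mp
      (ShortComplex.exact_of_g_is_cokernel (ShortComplex.mk T₃.toCycles T₃.homologyπ (by simp))
        T₃.homologyIsCokernel) _ hc
    obtain ⟨y, hy, w, hw⟩ := h (T₂.iCycles c)
      (ConcreteCategory.congr_hom T₂.iCycles_g c) z (by
        rw [← T₃.toCycles_i]
        refine (congrArg T₃.iCycles hz).trans ?_
        exact ConcreteCategory.congr_hom (ShortComplex.cyclesMap_i ψ) c)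
    let y' : T₁.cycles := T₁.moduleCatCyclesIso.inv ⟨y, hy⟩
    have hy' : T₁.iCycles y' = y :=
      ConcreteCategory.congr_hom T₁.moduleCatCyclesIso_inv_iCycles ⟨y, hy⟩
    refine ⟨T₁.homologyπ y', ?_⟩
    have hcyc : ShortComplex.cyclesMap φ y' = c + T₂.toCycles w := by
      apply (ModuleCat.mono_iff_injective T₂.iCycles).mp inferInstance
      rw [map_add]
      refine (ConcreteCategory.congr_hom (ShortComplex.cyclesMap_i φ) y').trans ?_
      refine (congrArg φ.τ₂ hy').trans (hw.trans ?_)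
      exact congrArg (T₂.iCycles c + ·) (ConcreteCategory.congr_hom T₂.toCycles_i w).symm
    refine (ConcreteCategory.congr_hom (ShortComplex.homologyπ_naturality φ) y').trans ?_
    refine (congrArg T₂.homologyπ hcyc).trans ?_
    rw [map_add]
    exact (congrArg (T₂.homologyπ c + ·)
      (ConcreteCategory.congr_hom T₂.toCycles_comp_homologyπ w)).trans (add_zero _)
  have hrange : S (ModuleCat.of R (LinearMap.range f)) := by
    have : Epi (ModuleCat.ofHom f.rangeRestrict) :=
      (ModuleCat.epi_iff_surjective _).mpr f.surjective_rangeRestrict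
    exact S.prop_of_epi (ModuleCat.ofHom f.rangeRestrict) h₁
  have hker : S (ModuleCat.of R (LinearMap.ker g)) := by
    have : Mono (ModuleCat.ofHom (Submodule.inclusion hle)) :=
      (ModuleCat.mono_iff_injective _).mpr (Submodule.inclusion_injective hle)
    exact S.prop_of_mono (ModuleCat.ofHom (Submodule.inclusion hle)) hrange
  refine S.prop_X₂_of_exact (S := ShortComplex.mk (ModuleCat.ofHom (LinearMap.ker g).subtype)
    (ShortComplex.homologyMap ψ) (by ext x; exact x.2)) ?_ hker h₃
  rw [ShortComplex.moduleCat_exact_iff]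
  exact fun x hx => ⟨⟨x, hx⟩, rfl⟩

/-- The fibre of a lift of a surjection `π` to injective resolutions is an injective resolution of
`ker π`. -/
theorem exists_injectiveResolution_fibre {P M : ModuleCat.{u} R} (π : P ⟶ M)
    (hπ : Function.Surjective π) (B : InjectiveResolution P) (C : InjectiveResolution M) :
    ∃ A : InjectiveResolution (ModuleCat.of R (LinearMap.ker π.hom)),
      A.cocomplex = fibre (InjectiveResolution.desc π C B) := by
  let g := InjectiveResolution.desc π C B
  let β : P ⟶ B.cocomplex.X 0 := B.ι.f 0
  let γ : M ⟶ C.cocomplex.X 0 := C.ι.f 0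
  have hg (p : P) : g.f 0 (β p) = γ (π p) :=
    ConcreteCategory.congr_hom (InjectiveResolution.desc_commutes_zero π C B) p
  have hβ : Function.Injective β :=
    (ModuleCat.mono_iff_injective (B.ι.f 0)).mp inferInstance
  have hγ : Function.Injective γ :=
    (ModuleCat.mono_iff_injective (C.ι.f 0)).mp inferInstance
  have hBd (p : P) : B.cocomplex.d 0 1 (β p) = 0 :=
    ConcreteCategory.congr_hom B.ι_f_zero_comp_complex_d p
  have hB₀ : ∀ b, B.cocomplex.d 0 1 b = 0 → ∃ p, β p = b :=
    (ShortComplex.moduleCat_exact_iff _).mp B.exact₀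
  have hC₀ : ∀ c, C.cocomplex.d 0 1 c = 0 → ∃ m, γ m = c :=
    (ShortComplex.moduleCat_exact_iff _).mp C.exact₀
  have hB (n) := (ShortComplex.moduleCat_exact_iff _).mp (B.exact_succ n)
  have hC (n) := (ShortComplex.moduleCat_exact_iff _).mp (C.exact_succ n)
  dsimp only at hB hC
  let ι : LinearMap.ker π.hom →ₗ[R] B.cocomplex.X 0 :=
    β.hom ∘ₗ (LinearMap.ker π.hom).subtype
  refine ⟨injectiveResolutionOfExact (fibre g) (injective_fibreX B.injective C.injective)
    (ModuleCat.ofHom ι) ?_ (hβ.comp Subtype.val_injective) ?_ ?_, rfl⟩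
  · rw [fibre_d]
    have h (x : LinearMap.ker π.hom) :
        (-(B.cocomplex.d 0 1 (β x.1)), g.f 0 (β x.1)) = (0, 0) := by
      have hx : π x.1 = 0 := x.2
      rw [hg, hBd, hx, map_zero, neg_zero]
    exact ModuleCat.hom_ext (LinearMap.ext h)
  · rw [fibre_d]
    have h (b : B.cocomplex.X 0) (hb : (-(B.cocomplex.d 0 1 b), g.f 0 b) = (0, 0)) :
        ∃ y, ι y = b := by
      obtain ⟨p, rfl⟩ := hB₀ b (neg_eq_zero.mp (Prod.ext_iff.mp hb).1)
      refine ⟨⟨p, hγ ?_⟩, rfl⟩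
      rw [map_zero]
      exact (hg p).symm.trans (Prod.ext_iff.mp hb).2
    exact h
  · intro n
    rw [fibre_d, fibre_d]
    cases n with
    | zero =>
      have h (b : B.cocomplex.X 1) (c : C.cocomplex.X 0)
          (hbc : (-(B.cocomplex.d 1 2 b), g.f 1 b + C.cocomplex.d 0 1 c) = (0, 0)) :
          ∃ y : B.cocomplex.X 0, (-(B.cocomplex.d 0 1 y), g.f 0 y) = (b, c) := by
        obtain ⟨b', rfl⟩ := hB 0 b (neg_eq_zero.mp (Prod.ext_iff.mp hbc).1)
        obtain ⟨m, hm⟩ := hC₀ (c + g.f 0 b') (by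
          rw [map_add, ← f_apply_d_apply]
          exact (add_comm _ _).trans (Prod.ext_iff.mp hbc).2)
        -- This is where surjectivity of `π` enters: its cokernel would be the `H¹` of the fibre.
        obtain ⟨p, rfl⟩ := hπ m
        refine ⟨β p - b', Prod.ext ?_ ?_⟩
        · rw [map_sub, hBd, zero_sub, neg_neg]
        · exact (map_sub (g.f 0).hom _ _).trans (sub_eq_iff_eq_add.mpr ((hg p).trans hm))
      exact fun x => h x.1 x.2
    | succ n =>
      have h (b : B.cocomplex.X (n + 2)) (c : C.cocomplex.X (n + 1))
          (hbc : (-(B.cocomplex.d (n + 2) (n + 3) b),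
            g.f (n + 2) b + C.cocomplex.d (n + 1) (n + 2) c) = (0, 0)) :
          ∃ y : B.cocomplex.X (n + 1) × C.cocomplex.X n,
            (-(B.cocomplex.d (n + 1) (n + 2) y.1),
              g.f (n + 1) y.1 + C.cocomplex.d n (n + 1) y.2) = (b, c) := by
        obtain ⟨b', rfl⟩ := hB (n + 1) b (neg_eq_zero.mp (Prod.ext_iff.mp hbc).1)
        obtain ⟨c', hc'⟩ := hC n (c + g.f (n + 1) b') (by
          rw [map_add, ← f_apply_d_apply]
          exact (add_comm _ _).trans (Prod.ext_iff.mp hbc).2)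
        refine ⟨(-b', c'), Prod.ext ?_ ?_⟩
        · rw [map_neg, neg_neg]
        · dsimp only
          rw [map_neg, hc', add_comm c, neg_add_cancel_left]
      exact fun x => h x.1 x.2

/-- The part `H^j(P) → H^j(M) → H^{j+1}(K)` of the long exact sequence of `0 → K → P → M → 0`, for
`j ≥ 1`, as seen by a Serre class. -/
theorem H_mem_of_surjective (I J : Ideal R) (S : ObjectProperty (ModuleCat.{u} R)) [S.IsSerreClass]
    {P M : ModuleCat.{u} R} (π : P ⟶ M) (hπ : Function.Surjective π) (k : ℕ)
    (hP : S (H I J (k + 1) P))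
    (hK : S (H I J (k + 2) (ModuleCat.of R (LinearMap.ker π.hom)))) :
    S (H I J (k + 1) M) := by
  let B := injectiveResolution P
  let C := injectiveResolution M
  obtain ⟨A, hA⟩ := exists_injectiveResolution_fibre π hπ B C
  let g := InjectiveResolution.desc π C B
  let F := (Γ I J).mapHomologicalComplex (ComplexShape.up ℕ)
  let sc (n : ℕ) := HomologicalComplex.shortComplexFunctor' (ModuleCat.{u} R)
    (ComplexShape.up ℕ) n (n + 1) (n + 2)
  have iso (K : CochainComplex (ModuleCat.{u} R) ℕ) (n : ℕ) :
      (F.obj K).homology (n + 1) ≅ ((sc n).obj (F.obj K)).homology :=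
    ShortComplex.homologyMapIso ((F.obj K).isoSc' n (n + 1) (n + 2) (by simp) (by simp))
  replace hP : S ((sc k).obj (F.obj B.cocomplex)).homology :=
    S.prop_of_iso (B.isoRightDerivedObj (Γ I J) (k + 1) ≪≫ iso _ k) hP
  replace hK : S ((sc (k + 1)).obj (F.obj (fibre g))).homology := by
    rw [← hA]
    exact S.prop_of_iso (A.isoRightDerivedObj (Γ I J) (k + 2) ≪≫ iso _ (k + 1)) hK
  refine S.prop_of_iso (C.isoRightDerivedObj (Γ I J) (k + 1) ≪≫ iso _ k).symm ?_
  -- The connecting map is induced by the inclusion of `C`, shifted by one, into the fibre.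
  let inr (n : ℕ) : C.cocomplex.X n ⟶ (fibre g).X (n + 1) :=
    ModuleCat.ofHom (LinearMap.inr R (B.cocomplex.X (n + 1)) (C.cocomplex.X n))
  have hinr (n : ℕ) :
      inr n ≫ (fibre g).d (n + 1) (n + 2) = C.cocomplex.d n (n + 1) ≫ inr (n + 1) := by
    rw [fibre_d]
    have h (c : C.cocomplex.X n) : (-(B.cocomplex.d (n + 1) (n + 2) 0),
        g.f (n + 1) 0 + C.cocomplex.d n (n + 1) c) = (0, C.cocomplex.d n (n + 1) c) := by
      simp
    exact ModuleCat.hom_ext (LinearMap.ext h)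
  let ψ : (sc k).obj (F.obj C.cocomplex) ⟶ (sc (k + 1)).obj (F.obj (fibre g)) :=
    { τ₁ := (Γ I J).map (inr k)
      τ₂ := (Γ I J).map (inr (k + 1))
      τ₃ := (Γ I J).map (inr (k + 2))
      comm₁₂ := by
        change (Γ I J).map _ ≫ (Γ I J).map _ = (Γ I J).map _ ≫ (Γ I J).map _
        rw [← Functor.map_comp, ← Functor.map_comp, hinr]
      comm₂₃ := by
        change (Γ I J).map _ ≫ (Γ I J).map _ = (Γ I J).map _ ≫ (Γ I J).map _
        rw [← Functor.map_comp, ← Functor.map_comp, hinr] }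
  refine prop_homology_of_hom S ((sc k).map (F.map g)) ψ ?_ hP hK
  rintro ⟨c, hc⟩ hdc ⟨z, hz⟩ hzc
  have hzc' : (fibre g).d (k + 1) (k + 2) z = inr (k + 1) c := congrArg Subtype.val hzc
  rw [fibre_d] at hzc'
  have h₁ : -(B.cocomplex.d (k + 1) (k + 2) z.1) = 0 := congrArg Prod.fst hzc'
  have h₂ : g.f (k + 1) z.1 + C.cocomplex.d k (k + 1) z.2 = c := congrArg Prod.snd hzc'
  have hz₁ := map_mem_torsion I J (LinearMap.fst R (B.cocomplex.X (k + 1)) (C.cocomplex.X k)) z hz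
  have hz₂ := map_mem_torsion I J (LinearMap.snd R (B.cocomplex.X (k + 1)) (C.cocomplex.X k)) z hz
  refine ⟨⟨z.1, hz₁⟩, Subtype.ext (neg_eq_zero.mp h₁), ⟨-z.2, neg_mem hz₂⟩, Subtype.ext ?_⟩
  change g.f (k + 1) z.1 = c + C.cocomplex.d k (k + 1) (-z.2)
  rw [map_neg, ← h₂, add_neg_cancel_right]

/-! ### Finite free modules and descending induction -/

instance rightDerived_additive (I J : Ideal R) (n : ℕ) : ((Γ I J).rightDerived n).Additive where
  map_add {X Y f g} := by
    let P := injectiveResolution X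
    let Q := injectiveResolution Y
    have h (φ ψ : P.cocomplex ⟶ Q.cocomplex)
        (hφ : P.ι ≫ φ = (CochainComplex.single₀ _).map f ≫ Q.ι)
        (hψ : P.ι ≫ ψ = (CochainComplex.single₀ _).map g ≫ Q.ι) :
        ((Γ I J).rightDerived n).map (f + g) =
          ((Γ I J).rightDerived n).map f + ((Γ I J).rightDerived n).map g := by
      rw [Functor.rightDerived_map_eq (Γ I J) n f φ hφ,
        Functor.rightDerived_map_eq (Γ I J) n g ψ hψ,
        Functor.rightDerived_map_eq (Γ I J) n (f + g) (φ + ψ) (by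
          rw [Preadditive.comp_add, hφ, hψ, Functor.map_add, Preadditive.add_comp]),
        Functor.map_add, Preadditive.add_comp, Preadditive.comp_add]
    exact h (InjectiveResolution.desc f _ _) (InjectiveResolution.desc g _ _) (by simp) (by simp)

theorem H_fin_fun (I J : Ideal R) (S : ObjectProperty (ModuleCat.{u} R)) [S.IsSerreClass] (j : ℕ)
    (h : S (H I J j (ModuleCat.of R R))) (n : ℕ) : S (H I J j (ModuleCat.of R (Fin n → R))) := by
  induction n with
  | zero =>
    refine S.prop_of_isZero (Functor.map_isZero _ ?_)
    exact ModuleCat.isZero_of_subsingleton _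
  | succ n ih =>
    let f : R →ₗ[R] (Fin (n + 1) → R) := LinearMap.single R (fun _ => R) 0
    let g : (Fin (n + 1) → R) →ₗ[R] (Fin n → R) := LinearMap.funLeft R R Fin.succ
    let T : ShortComplex (ModuleCat.{u} R) :=
      ShortComplex.mk (ModuleCat.ofHom f) (ModuleCat.ofHom g) (by
        have : g ∘ₗ f = 0 := by
          ext
          simp [f, g, LinearMap.funLeft_apply]
        exact ModuleCat.hom_ext this)
    let r : (Fin (n + 1) → R) →ₗ[R] R := LinearMap.proj 0
    let t : (Fin n → R) →ₗ[R] (Fin (n + 1) → R) :=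
      LinearMap.pi (Fin.cons 0 fun i => LinearMap.proj i)
    let s : T.Splitting :=
      { r := ModuleCat.ofHom r
        s := ModuleCat.ofHom t
        f_r := by
          have : r ∘ₗ f = LinearMap.id := by
            ext
            simp [r, f]
          exact ModuleCat.hom_ext this
        s_g := by
          have : g ∘ₗ t = LinearMap.id := by
            refine LinearMap.ext fun x => funext fun i => ?_
            simp [g, t, LinearMap.funLeft_apply]
          exact ModuleCat.hom_ext this
        id := by
          have : f ∘ₗ r + t ∘ₗ g = LinearMap.id := by
            refine LinearMap.ext fun x => funext fun i => ?_
            refine Fin.cases ?_ (fun i => ?_) i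
            · simp [f, r, g, t]
            · simp [f, r, g, t, LinearMap.funLeft_apply]
          exact ModuleCat.hom_ext this }
    exact S.prop_X₂_of_exact (s.map ((Γ I J).rightDerived j)).shortExact.exact h ih

/-- Descending induction on `j`, from the range where `H^j` vanishes: present `M` as a quotient of a
finite free module and apply the induction hypothesis to the kernel. -/
theorem H_mem_of_finite [IsNoetherianRing R] (I J : Ideal R) (S : ObjectProperty (ModuleCat.{u} R))
    [S.IsSerreClass] (r : ℕ) (h : ∀ j, r < j → S (H I J j (ModuleCat.of R R))) (j : ℕ) (hj : r < j)
    (M : ModuleCat.{u} R) (hM : Module.Finite R M) : S (H I J j M) := by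
  obtain ⟨s, hs⟩ := exists_forall_isZero_H I J
  -- The induction is on `m`, a bound for the distance of the degree `k + 1` from that range.
  suffices ∀ m k, s ≤ k + m → r < k + 1 → ∀ M : ModuleCat.{u} R, Module.Finite R M →
      S (H I J (k + 1) M) by
    obtain ⟨k, rfl⟩ : ∃ k, j = k + 1 := ⟨j - 1, by omega⟩
    exact this s k (by omega) hj M hM
  intro m
  induction m with
  | zero => exact fun k hk _ M _ => S.prop_of_isZero (hs k hk M)
  | succ m ih =>
    intro k hk hr M hM
    obtain ⟨n, f, hf⟩ := Module.Finite.exists_fin' R M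
    exact H_mem_of_surjective I J S (ModuleCat.ofHom f) hf k (H_fin_fun I J S _ (h _ hr) n)
      (ih (k + 1) (by omega) (by omega) _ (inferInstanceAs (Module.Finite R (LinearMap.ker f))))

end PairLC

theorem corollary4p23 {R : Type u} [CommRing R] [IsNoetherianRing R] (I J : Ideal R)
    (S : ObjectProperty (ModuleCat.{u} R)) [S.IsSerreClass] :
    PairLC.cd S I J (ModuleCat.of R R) =
        sSup {d : ℕ∞ | ∃ N : ModuleCat.{u} R, Module.Finite R N ∧ d = PairLC.cd S I J N} ∧
      ∀ r : ℕ,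
        (∀ j : ℕ, r < j → S (PairLC.H I J j (ModuleCat.of R R))) ↔
          (∀ j : ℕ, r < j → ∀ M : ModuleCat.{u} R, Module.Finite R M → S (PairLC.H I J j M)) := by
  refine ⟨le_antisymm (le_sSup ⟨_, Module.Finite.self R, rfl⟩) (sSup_le ?_), fun r =>
    ⟨PairLC.H_mem_of_finite I J S r, fun h j hj => h j hj _ (Module.Finite.self R)⟩⟩
  rintro _ ⟨N, hN, rfl⟩
  refine sSup_le ?_
  rintro _ ⟨i, hi, rfl⟩
  by_contra! hlt
  obtain ⟨r, hr⟩ := ENat.ne_top_iff_exists.mp hlt.ne_top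
  rw [← hr] at hlt
  refine hi (PairLC.H_mem_of_finite I J S r (fun j hj => ?_) i (ENat.natCast_lt_natCast.mp hlt) N hN)
  by_contra hS
  have : (j : ℕ∞) ≤ r := hr ▸ le_sSup ⟨j, hS, rfl⟩
  exact absurd (ENat.natCast_le_natCast.mp this) (by omega)
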